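/- Let $\kappa=l/2$ with $l\ge 1$ an odd integer, and for $N\ge 1$ let $S_\kappa(\Gamma_1(4N))$ be the space of cusp forms of weight $\kappa$ on $\Gamma_1(4N)$, that is, of holomorphic functions $f$ on the upper half plane with $f(\gamma\tau)=j(\gamma,\tau)^{l}f(\tau)$ for all $\gamma\in\Gamma_1(4N)$ that vanish at all cusps, where $j(\gamma,\tau)=\theta(\gamma\tau)/\theta(\tau)$ and $\theta(\tau)=\sum_{n\in\mathbb Z}e^{2\pi i n^2\tau}$. Write $f(\tau)=\sum_{n}a(f,n)e^{2\pi i n\tau}$ for the Fourier expansion at $\infty$. Let $L\ge 1$ be an integer and let $L_f$ be an even positive divisor of $4L$. Put $L_f'=\prod_{p\mid L_f}p$, let $p_1,\dots,p_r$ be the distinct primes that divide $L$ but not $L_f$, and let $\alpha_j\ge 1$ be the exponent of $p_j$ in the prime factorization of $L$. Suppose that $f\in S_\kappa(\Gamma_1(4L))$ is non-zero and $a(f,n)=0$ whenever $(n,L_f)>1$. Then there exist integers $i_1,\dots,i_r$ with $0\le i_j\le\alpha_j$ for $1\le j\le r$ and a non-zero cusp form $g\in S_\kappa\big(\Gamma_1(4L\,L_f'^2\,p_1^{2-i_1}\cdots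 p_r^{2-i_r})\big)$ such that 1. $a(g,n)=0$ whenever $(n,4L)>1$; 2. $a(g,n)=a(f,p_1^{i_1}\cdots p_r^{i_r}n)$ whenever $(n,4L)=1$. -/

import Mathlib

open scoped MatrixGroups Manifold

noncomputable section

namespace HalfIntWeight

open UpperHalfPlane

/-- The extended quadratic residue symbol `(c/d)` for odd `d` of either sign:
`(c/d) = (c/|d|)`, the Jacobi symbol, unless `c` and `d` are both negative, in which case
`(c/d) = -(c/|d|)`. In particular `(0/±1) = 1`. -/
def extSymbol (c d : ℤ) : ℤ :=
  if c < 0 ∧ d < 0 then -jacobiSym c d.natAbs else jacobiSym c d.natAbs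

/-- `ε_d = 1` if `d ≡ 1 mod 4` and `ε_d = i` if `d ≡ 3 mod 4`. -/
def epsFactor (d : ℤ) : ℂ := if d % 4 = 1 then 1 else Complex.I

/-- The principal branch (argument in `(-π/2, π/2]`) of `(cτ + d)^{1/2}`, where `(c, d)` is the
lower row of `γ`. -/
def sqrtDenom (γ : SL(2, ℤ)) (τ : ℍ) : ℂ :=
  (((γ 1 0 : ℤ) : ℂ) * (τ : ℂ) + ((γ 1 1 : ℤ) : ℂ)) ^ ((1 : ℂ) / 2)

/-- The theta automorphy factor `j(γ, τ) = ε_d⁻¹ (c/d) (cτ + d)^{1/2}` for `γ ∈ Γ₀(4)`. It equals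
`θ(γτ)/θ(τ)`, where `θ(τ) = ∑_{n ∈ ℤ} e^{2πi n² τ}`. -/
def thetaFactor (γ : SL(2, ℤ)) (τ : ℍ) : ℂ :=
  (epsFactor (γ 1 1))⁻¹ * (extSymbol (γ 1 0) (γ 1 1) : ℂ) * sqrtDenom γ τ

/-- The space `S_{l/2}(Γ₁(4N))` of cusp forms of weight `l/2` (`l` odd) on `Γ₁(4N)`: holomorphic
functions on the upper half plane with `f(γτ) = j(γ, τ)^l f(τ)` for `γ ∈ Γ₁(4N)` that vanish at
every cusp, i.e. `(cτ + d)^{-l/2} f(γτ) → 0` as `Im τ → ∞` for every `γ ∈ SL₂(ℤ)`. -/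
def cuspForms (l N : ℕ) : Submodule ℂ (ℍ → ℂ) where
  carrier := {f |
    MDiff f ∧
    (∀ γ ∈ CongruenceSubgroup.Gamma1 (4 * N), ∀ τ : ℍ, f (γ • τ) = thetaFactor γ τ ^ l * f τ) ∧
    ∀ γ : SL(2, ℤ), IsZeroAtImInfty fun τ : ℍ => (sqrtDenom γ τ ^ l)⁻¹ * f (γ • τ)}
  add_mem' := by
    rintro f g ⟨hf, hf', hf''⟩ ⟨hg, hg', hg''⟩
    refine ⟨hf.add hg, fun γ hγ τ => ?_, fun γ => ?_⟩
    · simp only [Pi.add_apply, hf' γ hγ, hg' γ hγ, mul_add]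
    · have h := Filter.Tendsto.add (hf'' γ) (hg'' γ)
      simpa only [IsZeroAtImInfty, Filter.ZeroAtFilter, Pi.add_apply, mul_add, add_zero] using h
  zero_mem' := by
    refine ⟨mdifferentiable_const, fun γ _ τ => by simp, fun γ => ?_⟩
    simp [IsZeroAtImInfty, Filter.ZeroAtFilter]
  smul_mem' := by
    rintro a f ⟨hf, hf', hf''⟩
    refine ⟨hf.const_smul a, fun γ hγ τ => ?_, fun γ => ?_⟩
    · simp only [Pi.smul_apply, smul_eq_mul, hf' γ hγ, mul_left_comm]
    · have h := Filter.Tendsto.const_mul a (hf'' γ)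
      simpa only [IsZeroAtImInfty, Filter.ZeroAtFilter, Pi.smul_apply, smul_eq_mul, mul_zero,
        mul_left_comm] using h

/-- The `n`-th Fourier coefficient `a(f, n)` in `f(τ) = ∑_n a(f, n) e^{2πi n τ}`. -/
def qCoeff (f : ℍ → ℂ) (n : ℕ) : ℂ := (qExpansion 1 f).coeff n

end HalfIntWeight

end

/-! The primes of `L` outside `Lf` are odd, and they are treated one at a time. If some nonzero
coefficient of f has index prime to p, averaging the translates f(τ + k/p) and subtracting removes
the multiples of p (`sieve`), at the cost of p² in the level, and the result is nonzero.

Otherwise f is a series in q^p, so h(τ) = f(τ/p) has period one. Conjugating by diag(1, p) gives h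
the factor of f twisted by the symbol (p/d); multiplying the matrix by integer translations on both
sides changes d to d + ck without changing h. If p divides the level, this freedom removes the
twist, and h is a form of level divided by p (`comp_affineMap_mem_of_periodic`). If p does not
divide the level, it yields two transformation laws for one matrix that differ by (-1)^l = -1, so f
= 0 (`eq_zero_of_periodic`). Hence the descent from f to h happens at most v times, v being the
exponent of p in the level, before the sieve gives something nonzero (`exists_sieve_prime`). An
induction over the primes finishes the proof; at primes dividing `Lf` the coefficients vanish by
hypothesis. -/

namespace HalfIntWeight

open UpperHalfPlane

/-! ### Periodicity of the quadratic symbol in its lower argument. -/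

section Symbol

theorem jacobiSym_congr_right {a : ℤ} {m n : ℕ} (hm : Odd m) (hn : Odd n)
    (h : (4 * a) ∣ (m : ℤ) - n) : jacobiSym a m = jacobiSym a n := by
  rw [jacobiSym.mod_right a hm, jacobiSym.mod_right a hn]
  congr 1
  have h' : ((4 * a.natAbs : ℕ) : ℤ) ∣ (m : ℤ) - n := by
    rw [Nat.cast_mul, Int.natCast_natAbs]
    rw [← abs_dvd] at h
    simpa [abs_mul] using h
  exact (Nat.modEq_iff_dvd.mpr h').symm

/-- With b = 4|a| - 1, the numerator a may be replaced by 4a ≡ ±1 mod b, the sign being that of a,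
and b ≡ 3 mod 4. -/
theorem jacobiSym_four_mul_natAbs_sub_one {a : ℤ} (ha : a ≠ 0) :
    jacobiSym a (4 * a.natAbs - 1) = if a < 0 then -1 else 1 := by
  set b := 4 * a.natAbs - 1 with hb
  have hpos : 0 < a.natAbs := Int.natAbs_pos.mpr ha
  have hodd : Odd b := by rw [Nat.odd_iff]; omega
  have h4 : jacobiSym (4 * a) b = jacobiSym a b := by
    rw [jacobiSym.mul_left, jacobiSym.at_four hodd, one_mul]
  rw [← h4]
  split_ifs with h
  · have e : (4 * a) % (b : ℤ) = (-1) % (b : ℤ) :=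
      (Int.modEq_iff_dvd.mpr ⟨1, by omega⟩ : (4 * a) ≡ -1 [ZMOD b])
    rw [jacobiSym.mod_left' e, jacobiSym.at_neg_one hodd,
      ZMod.χ₄_nat_three_mod_four (by omega)]
  · have e : (4 * a) % (b : ℤ) = 1 % (b : ℤ) :=
      (Int.modEq_iff_dvd.mpr ⟨-1, by omega⟩ : (4 * a) ≡ 1 [ZMOD b])
    rw [jacobiSym.mod_left' e, jacobiSym.one_left]

/-- Here mn ≡ (4|a| - 1)n² mod 4a, so the product of the two symbols is sgn(a) times a square. The
sign is what the convention in `extSymbol` absorbs when d changes sign. -/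
theorem jacobiSym_congr_neg_right {a : ℤ} (ha : a ≠ 0) {m n : ℕ} (hm : Odd m) (hn : Odd n)
    (h : (4 * a) ∣ (m : ℤ) + n) :
    jacobiSym a m = if a < 0 then -jacobiSym a n else jacobiSym a n := by
  have hpos : 0 < a.natAbs := Int.natAbs_pos.mpr ha
  have key : ∀ {m n : ℕ}, Odd m → Odd n → (4 * a) ∣ (m : ℤ) + n →
      jacobiSym a m * jacobiSym a n = (if a < 0 then -1 else 1) * jacobiSym a n ^ 2 := by
    intro m n hm hn h
    have hm0 : m ≠ 0 := hm.pos.ne'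
    have hn0 : n ≠ 0 := hn.pos.ne'
    have hb : Odd (4 * a.natAbs - 1) := by rw [Nat.odd_iff]; omega
    rw [← jacobiSym.mul_right' a hm0 hn0, ← jacobiSym_four_mul_natAbs_sub_one ha,
      ← jacobiSym.pow_right, ← jacobiSym.mul_right' a hb.pos.ne' (pow_ne_zero 2 hn0)]
    refine jacobiSym_congr_right (hm.mul hn) (hb.mul (hn.pow)) ?_
    have e : ((4 * a.natAbs - 1 : ℕ) : ℤ) = 4 * |a| - 1 := by
      rw [Nat.cast_sub (by omega)]; simp
    have ea : (4 * a) ∣ 4 * |a| := mul_dvd_mul_left 4 ((dvd_abs a a).mpr dvd_rfl)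
    push_cast
    rw [e]
    have : (m : ℤ) * n - (4 * |a| - 1) * n ^ 2 = (m + n) * n - 4 * |a| * n ^ 2 := by ring
    rw [this]
    exact dvd_sub (h.mul_right _) (ea.mul_right _)
  have h1 := key hm hn h
  have h2 := key hn hm (by rwa [add_comm])
  by_cases h0 : jacobiSym a n = 0
  · have : jacobiSym a m = 0 := by
      rw [h0] at h2
      split_ifs at h2 <;> simpa using h2.symm
    simp [this, h0]
  · have := mul_right_cancel₀ h0 (h1.trans (by rw [sq, ← mul_assoc]))
    rw [this]; split_ifs <;> ring

/-- The symbol `(a/d)` depends on `d` only modulo `4a`. -/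
theorem extSymbol_congr {a d d' : ℤ} (ha : a ≠ 0) (hd : Odd d) (h : (4 * a) ∣ d' - d) :
    extSymbol a d' = extSymbol a d := by
  have hd' : Odd d' := by
    have : Even (d' - d) := even_iff_two_dvd.mpr ((Dvd.intro (2 * a) (by ring)).trans h)
    simpa using this.add_odd hd
  have h1 : Odd d.natAbs := Int.natAbs_odd.mpr hd
  have h2 : Odd d'.natAbs := Int.natAbs_odd.mpr hd'
  unfold extSymbol
  rcases lt_or_ge d 0 with s | s <;> rcases lt_or_ge d' 0 with s' | s'
  · have : jacobiSym a d'.natAbs = jacobiSym a d.natAbs :=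
      jacobiSym_congr_right h2 h1 (by rw [← dvd_neg]; convert! h using 1; omega)
    simp [s, s', this]
  · have := jacobiSym_congr_neg_right ha h2 h1 (by convert h using 1; omega)
    rw [this]; simp [s, s'.not_gt]
  · have := jacobiSym_congr_neg_right ha h2 h1 (by rw [← dvd_neg]; convert! h using 1; omega)
    rw [this]; simp only [s', s.not_gt, and_true, and_false, if_false]; split_ifs <;> ring
  · have : jacobiSym a d'.natAbs = jacobiSym a d.natAbs :=
      jacobiSym_congr_right h2 h1 (by convert h using 1; omega)
    simp [s.not_gt, s'.not_gt, this]

theorem extSymbol_mul_of_pos {m : ℤ} (hm : 0 < m) (c d : ℤ) :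
    extSymbol (m * c) d = jacobiSym m d.natAbs * extSymbol c d := by
  have : m * c < 0 ↔ c < 0 := by simp [mul_neg_iff, hm, hm.not_gt]
  unfold extSymbol
  simp only [this, jacobiSym.mul_left]
  split_ifs <;> ring

theorem extSymbol_sq_mul {m : ℤ} (hm : 0 < m) {c d : ℤ} (h : IsCoprime m d) :
    extSymbol (m ^ 2 * c) d = extSymbol c d := by
  rw [extSymbol_mul_of_pos (by positivity), jacobiSym.sq_one', one_mul]
  simpa [Int.gcd, Int.natAbs_abs] using Int.isCoprime_iff_gcd_eq_one.mp h

theorem extSymbol_four_mul {c d : ℤ} (h : Odd d) : extSymbol (4 * c) d = extSymbol c d := by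
  rw [extSymbol_mul_of_pos (by norm_num), jacobiSym.at_four (Int.natAbs_odd.mpr h), one_mul]

/-- For `4 ∣ c` the symbol `(c/d)` depends on `d` only modulo `c`. -/
theorem extSymbol_add_mul {c d : ℤ} (hc : 4 ∣ c) (hd : Odd d) (k : ℤ) :
    extSymbol c (d + c * k) = extSymbol c d := by
  obtain ⟨a, rfl⟩ := hc
  rcases eq_or_ne a 0 with rfl | ha
  · simp
  have hd' : Odd (d + 4 * a * k) := hd.add_even ⟨2 * a * k, by ring⟩
  rw [extSymbol_four_mul hd, extSymbol_four_mul hd']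
  exact extSymbol_congr ha hd ⟨k, by ring⟩

theorem jacobiSym_natAbs_congr {m d d' : ℤ} (hm : 0 < m) (hd : Odd d) (h : (4 * m) ∣ d' - d) :
    jacobiSym m d'.natAbs = jacobiSym m d.natAbs := by
  simpa [extSymbol, hm.not_gt] using extSymbol_congr hm.ne' hd h

end Symbol

/-! ### The theta factor as a function of the lower row. -/

section Automorphy

/-- The theta automorphy factor as a function of the lower row `(c, d)`. -/
noncomputable def thetaAut (c d : ℤ) (τ : ℍ) : ℂ :=
  (epsFactor d)⁻¹ * (extSymbol c d : ℂ) * ((c : ℂ) * τ + d) ^ ((1 : ℂ) / 2)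

theorem thetaFactor_eq_thetaAut (γ : SL(2, ℤ)) (τ : ℍ) :
    thetaFactor γ τ = thetaAut (γ 1 0) (γ 1 1) τ := rfl

theorem thetaAut_zero_one (τ : ℍ) : thetaAut 0 1 τ = 1 := by
  simp [thetaAut, epsFactor, extSymbol]

theorem thetaAut_congr {c d d' : ℤ} {τ w : ℍ} (h4 : 4 ∣ d' - d)
    (hs : extSymbol c d' = extSymbol c d) (h : (c : ℂ) * w + d' = c * τ + d) :
    thetaAut c d' w = thetaAut c d τ := by
  have : d' % 4 = d % 4 := by omega
  simp [thetaAut, epsFactor, this, hs, h]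

theorem thetaAut_mul_left {m : ℤ} (hm : 0 < m) (c d : ℤ) {τ w : ℍ} (h : (m : ℂ) * w = τ) :
    thetaAut (m * c) d w = jacobiSym m d.natAbs * thetaAut c d τ := by
  have : ((m * c : ℤ) : ℂ) * w + d = c * τ + d := by rw [← h]; push_cast; ring
  rw [thetaAut, thetaAut, this, extSymbol_mul_of_pos hm]
  push_cast; ring

theorem linear_ne_zero {c d : ℤ} (h : IsCoprime c d) (τ : ℍ) : (c : ℂ) * τ + d ≠ 0 := by
  intro h0
  have hi := congrArg Complex.im h0
  have hr := congrArg Complex.re h0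
  have hc : c = 0 := by simpa [τ.im_pos.ne'] using hi
  subst hc
  have hd : d = 0 := by simpa using hr
  subst hd
  exact not_isUnit_zero (isCoprime_zero_left.mp h)

theorem thetaAut_ne_zero {c d : ℤ} (h : IsCoprime c d) (τ : ℍ) : thetaAut c d τ ≠ 0 := by
  have h1 : epsFactor d ≠ 0 := by unfold epsFactor; split_ifs <;> simp
  have h2 : extSymbol c d ≠ 0 := by
    have : jacobiSym c d.natAbs ≠ 0 :=
      jacobiSym.ne_zero (by simpa [Int.gcd, Int.natAbs_abs] using Int.isCoprime_iff_gcd_eq_one.mp h)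
    unfold extSymbol; split_ifs <;> simpa
  have h4 : ((c : ℂ) * τ + d) ^ ((1 : ℂ) / 2) ≠ 0 := by
    rw [Complex.cpow_def_of_ne_zero (linear_ne_zero h τ)]; exact Complex.exp_ne_zero _
  exact mul_ne_zero (mul_ne_zero (inv_ne_zero h1) (mod_cast h2)) h4

end Automorphy

/-! ### Branches of the square root and the cocycle relation. -/

section Cocycle

theorem sqrt_mul_of_arg_add_mem {x z : ℂ} (hx : x ≠ 0) (hz : z ≠ 0)
    (h : x.arg + z.arg ∈ Set.Ioc (-Real.pi) Real.pi) :
    (x * z) ^ ((1 : ℂ) / 2) = x ^ ((1 : ℂ) / 2) * z ^ ((1 : ℂ) / 2) := by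
  rw [Complex.cpow_def_of_ne_zero (mul_ne_zero hx hz), Complex.cpow_def_of_ne_zero hx,
    Complex.cpow_def_of_ne_zero hz, Complex.log_mul hx hz h, ← Complex.exp_add, add_mul]

theorem log_mul_of_pi_lt {x z : ℂ} (hx : x ≠ 0) (hz : z ≠ 0)
    (h : Real.pi < x.arg + z.arg) :
    Complex.log (x * z) = Complex.log x + Complex.log z - 2 * Real.pi * Complex.I := by
  have e : x * z = Complex.exp (Complex.log x + Complex.log z - 2 * Real.pi * Complex.I) := by
    rw [Complex.exp_sub, Complex.exp_add, Complex.exp_log hx, Complex.exp_log hz,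
      Complex.exp_two_pi_mul_I, div_one]
  have h1 := Complex.arg_le_pi x
  have h2 := Complex.arg_le_pi z
  have hpi := Real.pi_pos
  rw [e, Complex.log_exp] <;> simp [Complex.log_im] <;> linarith

theorem sqrt_mul_of_pi_lt {x z : ℂ} (hx : x ≠ 0) (hz : z ≠ 0)
    (h : Real.pi < x.arg + z.arg) :
    (x * z) ^ ((1 : ℂ) / 2) = -(x ^ ((1 : ℂ) / 2) * z ^ ((1 : ℂ) / 2)) := by
  rw [Complex.cpow_def_of_ne_zero (mul_ne_zero hx hz), Complex.cpow_def_of_ne_zero hx,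
    Complex.cpow_def_of_ne_zero hz, log_mul_of_pi_lt hx hz h, ← Complex.exp_add, ← add_mul,
    sub_mul, Complex.exp_sub]
  have : (2 * Real.pi * Complex.I) * ((1 : ℂ) / 2) = Real.pi * Complex.I := by ring
  rw [this, Complex.exp_pi_mul_I, div_neg, div_one]

/-- The cocycle relation of the theta automorphy factor for right multiplication by
`(1 0; m 1)`. -/
theorem thetaAut_add_mul {c d m : ℤ} (hm : 0 < m) (hcd : IsCoprime c d) {τ w : ℍ}
    (hw : (w : ℂ) * (m * τ + 1) = τ) :
    thetaAut (c + m * d) d τ = thetaAut c d w * thetaAut m 1 τ := by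
  have hm1 : thetaAut m 1 τ = ((m : ℂ) * τ + 1) ^ ((1 : ℂ) / 2) := by
    simp [thetaAut, epsFactor, extSymbol, hm.not_gt]
  set z : ℂ := (m : ℂ) * τ + 1 with hz
  set x : ℂ := (c : ℂ) * w + d with hx
  have hzim : 0 < z.im := by
    have : (0 : ℝ) < m := by exact_mod_cast hm
    simpa [hz] using mul_pos this τ.im_pos
  have hxim : x.im = c * w.im := by simp [hx]
  have hz0 : z ≠ 0 := fun h => by simp [h] at hzim
  have hx0 : x ≠ 0 := by
    intro h
    have := thetaAut_ne_zero hcd w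
    rw [thetaAut, ← hx, h] at this
    simp at this
  have hxz : ((c + m * d : ℤ) : ℂ) * τ + d = x * z := by
    have : x * z = c * (w * z) + d * z := by ring
    rw [this, hw, hz]; push_cast; ring
  have hxzim : (x * z).im = (c + m * d : ℤ) * τ.im := by rw [← hxz]; simp
  have hzarg : 0 < z.arg ∧ z.arg < Real.pi := by
    refine ⟨lt_of_le_of_ne (Complex.arg_nonneg_iff.mpr hzim.le) fun h => ?_,
      lt_of_le_of_ne (Complex.arg_le_pi z) fun h => ?_⟩
    · have := (Complex.arg_eq_zero_iff.mp h.symm).2; exact hzim.ne' this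
    · have := (Complex.arg_eq_pi_iff.mp h).2; exact hzim.ne' this
  have hJ : jacobiSym (c + m * d) d.natAbs = jacobiSym c d.natAbs :=
    jacobiSym.mod_left' (Int.modEq_iff_dvd.mpr
      (Int.natAbs_dvd.mpr ⟨-m, by ring⟩) : c + m * d ≡ c [ZMOD d.natAbs])
  rw [hm1, thetaAut, thetaAut, hxz, ← hx]
  -- The product x * z crosses the branch cut exactly when c ≥ 0 and c + md < 0, which forces d < 0.
  -- That is exactly when `extSymbol` acquires its extra sign, so the two signs cancel.
  rcases lt_or_ge c 0 with hc | hc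
  · have hxneg : x.arg < 0 := by
      rw [Complex.arg_neg_iff, hxim]
      exact mul_neg_of_neg_of_pos (by exact_mod_cast hc) w.im_pos
    have hs : extSymbol (c + m * d) d = extSymbol c d := by
      rcases lt_or_ge d 0 with hd | hd
      · have : c + m * d < 0 := by nlinarith
        simp [extSymbol, hJ, hd, hc, this]
      · simp [extSymbol, hJ, hd.not_gt]
    have := Complex.neg_pi_lt_arg x
    rw [hs, sqrt_mul_of_arg_add_mem hx0 hz0 ⟨by linarith, by linarith⟩]
    ring
  · have hxpos : 0 ≤ x.arg := by
      rw [Complex.arg_nonneg_iff, hxim]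
      exact mul_nonneg (by exact_mod_cast hc) w.im_pos.le
    have hxpi := Complex.arg_le_pi x
    rcases lt_or_ge (c + m * d) 0 with hcd' | hcd'
    · have hd : d < 0 := by by_contra! hd; nlinarith
      have hpi : Real.pi < x.arg + z.arg := by
        by_contra! hle
        have h := Complex.arg_mul (x := x) (y := z) hx0 hz0 ⟨by linarith [Real.pi_pos], hle⟩
        have h' : 0 ≤ (x * z).im := Complex.arg_nonneg_iff.mp (by rw [h]; linarith)
        rw [hxzim] at h'
        have : ((c + m * d : ℤ) : ℝ) < 0 := by exact_mod_cast hcd'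
        nlinarith [τ.im_pos]
      rw [sqrt_mul_of_pi_lt hx0 hz0 hpi]
      simp only [extSymbol, hJ, hd, hcd', hc.not_gt, and_self, false_and, if_true, if_false]
      push_cast; ring
    · have hpi : x.arg + z.arg ≤ Real.pi := by
        by_contra! hlt
        have h := congrArg Complex.im (log_mul_of_pi_lt hx0 hz0 hlt)
        simp [Complex.log_im] at h
        have h' : (x * z).im < 0 := Complex.arg_neg_iff.mp (by rw [h]; linarith)
        rw [hxzim] at h'
        have : (0 : ℝ) ≤ ((c + m * d : ℤ) : ℝ) := by exact_mod_cast hcd'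
        nlinarith [τ.im_pos]
      rw [sqrt_mul_of_arg_add_mem hx0 hz0 ⟨by linarith [Real.pi_pos], hpi⟩]
      simp only [extSymbol, hJ, hcd'.not_gt, hc.not_gt, false_and, if_false]
      ring

end Cocycle

/-! ### Cusp forms described by matrix entries. -/

section Relational

/-- `f(γτ) = j(γ, τ)^l f(τ)` for `γ = (a b; c d)`, stated without reference to the action. -/
def Transforms (l : ℕ) (f : ℍ → ℂ) (a b c d : ℤ) : Prop :=
  ∀ τ w : ℍ, (w : ℂ) * (c * τ + d) = a * τ + b → f w = thetaAut c d τ ^ l * f τ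

/-- `f` vanishes at every cusp, in weight `l / 2`. -/
def VanishesAtCusps (l : ℕ) (f : ℍ → ℂ) : Prop :=
  ∀ a b c d : ℤ, a * d - b * c = 1 → ∀ ε : ℝ, 0 < ε → ∃ Y : ℝ, ∀ τ w : ℍ, Y ≤ τ.im →
    (w : ℂ) * (c * τ + d) = a * τ + b → ‖f w‖ ^ 2 ≤ ε * ‖(c : ℂ) * τ + d‖ ^ l

/-- The integer matrix `(a b; c d)` of determinant one. -/
def mkSL (a b c d : ℤ) (h : a * d - b * c = 1) : SL(2, ℤ) :=
  ⟨!![a, b; c, d], by rw [Matrix.det_fin_two_of, h]⟩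

theorem isCoprime_of_det {a b c d : ℤ} (h : a * d - b * c = 1) : IsCoprime c d :=
  ⟨-b, a, by linarith⟩

theorem smul_eq_iff (γ : SL(2, ℤ)) (τ w : ℍ) :
    γ • τ = w ↔ (w : ℂ) * ((γ 1 0 : ℤ) * τ + (γ 1 1 : ℤ)) = (γ 0 0 : ℤ) * τ + (γ 0 1 : ℤ) := by
  have hdet : γ 0 0 * γ 1 1 - γ 0 1 * γ 1 0 = 1 := by
    rw [← Matrix.det_fin_two]; exact γ.2
  have h0 := linear_ne_zero (isCoprime_of_det hdet) τ
  rw [UpperHalfPlane.ext_iff, coe_specialLinearGroup_apply]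
  simp only [algebraMap_int_eq, eq_intCast, Complex.ofReal_intCast]
  rw [div_eq_iff h0, eq_comm]

theorem norm_sqrtDenom_sq (γ : SL(2, ℤ)) (τ : ℍ) :
    ‖sqrtDenom γ τ‖ ^ 2 = ‖((γ 1 0 : ℤ) : ℂ) * τ + (γ 1 1 : ℤ)‖ := by
  rw [← norm_pow, sqrtDenom, ← Complex.cpow_nat_mul]
  norm_num

theorem mem_Gamma1_iff {N : ℕ} (γ : SL(2, ℤ)) :
    γ ∈ CongruenceSubgroup.Gamma1 N ↔ (N : ℤ) ∣ γ 1 0 ∧ (N : ℤ) ∣ γ 1 1 - 1 := by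
  have hdet : γ 0 0 * γ 1 1 - γ 0 1 * γ 1 0 = 1 := by
    rw [← Matrix.det_fin_two]; exact γ.2
  rw [CongruenceSubgroup.Gamma1_mem, ← ZMod.intCast_zmod_eq_zero_iff_dvd,
    ← ZMod.intCast_zmod_eq_zero_iff_dvd, Int.cast_sub, Int.cast_one, sub_eq_zero]
  refine ⟨fun h => ⟨h.2.2, h.2.1⟩, fun h => ⟨?_, h.2, h.1⟩⟩
  have := congrArg (Int.cast : ℤ → ZMod N) hdet
  push_cast at this
  rw [h.1, h.2] at this
  simpa using this

/-- Squaring the norms turns |cτ + d|^(l/2) into an integral power, so no root remains. -/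
theorem vanishesAtCusps_iff (l : ℕ) (f : ℍ → ℂ) :
    VanishesAtCusps l f ↔
      ∀ γ : SL(2, ℤ), IsZeroAtImInfty fun τ : ℍ => (sqrtDenom γ τ ^ l)⁻¹ * f (γ • τ) := by
  have key (γ : SL(2, ℤ)) (τ : ℍ) (ε : ℝ) (hε : 0 < ε) :
      ‖(sqrtDenom γ τ ^ l)⁻¹ * f (γ • τ)‖ ≤ ε ↔
        ‖f (γ • τ)‖ ^ 2 ≤ ε ^ 2 * ‖((γ 1 0 : ℤ) : ℂ) * τ + (γ 1 1 : ℤ)‖ ^ l := by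
    have hdet : γ 0 0 * γ 1 1 - γ 0 1 * γ 1 0 = 1 := by
      rw [← Matrix.det_fin_two]; exact γ.2
    have h0 := linear_ne_zero (isCoprime_of_det hdet) τ
    have h1 : 0 < ‖sqrtDenom γ τ‖ := by
      have : 0 < ‖sqrtDenom γ τ‖ ^ 2 := by rw [norm_sqrtDenom_sq]; exact norm_pos_iff.mpr h0
      exact lt_of_le_of_ne (norm_nonneg _) fun h => by rw [← h] at this; simp at this
    rw [norm_mul, norm_inv, norm_pow, inv_mul_le_iff₀ (pow_pos h1 l), ← norm_sqrtDenom_sq,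
      ← pow_mul, mul_comm 2 l, pow_mul, ← mul_pow, mul_comm ε,
      pow_le_pow_iff_left₀ (norm_nonneg _) (by positivity) two_ne_zero]
  constructor
  · intro h γ
    have hdet : γ 0 0 * γ 1 1 - γ 0 1 * γ 1 0 = 1 := by
      rw [← Matrix.det_fin_two]; exact γ.2
    rw [isZeroAtImInfty_iff]
    intro ε hε
    obtain ⟨Y, hY⟩ := h _ _ _ _ hdet (ε ^ 2) (by positivity)
    exact ⟨Y, fun τ hτ => (key γ τ ε hε).mpr (hY τ _ hτ ((smul_eq_iff γ τ _).mp rfl))⟩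
  · intro h a b c d hdet ε hε
    obtain ⟨Y, hY⟩ := isZeroAtImInfty_iff.mp (h (mkSL a b c d hdet)) (√ε) (by positivity)
    refine ⟨Y, fun τ w hτ hw => ?_⟩
    have hw' : mkSL a b c d hdet • τ = w := (smul_eq_iff _ τ w).mpr (by simpa [mkSL] using hw)
    have := (key _ τ _ (by positivity)).mp (hY τ hτ)
    rw [hw', Real.sq_sqrt hε.le] at this
    simpa [mkSL] using this

theorem mem_cuspForms_iff {l N : ℕ} {f : ℍ → ℂ} :
    f ∈ cuspForms l N ↔ MDiff f ∧
      (∀ a b c d : ℤ, a * d - b * c = 1 → (4 * N : ℤ) ∣ c → (4 * N : ℤ) ∣ d - 1 →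
        Transforms l f a b c d) ∧ VanishesAtCusps l f := by
  rw [vanishesAtCusps_iff]
  refine and_congr_right fun _ => and_congr_left fun _ => ⟨?_, ?_⟩
  · intro h a b c d hdet hc hd τ w hw
    have hw' : mkSL a b c d hdet • τ = w := (smul_eq_iff _ τ w).mpr (by simpa [mkSL] using hw)
    have := h (mkSL a b c d hdet)
      ((mem_Gamma1_iff _).mpr (by simpa [mkSL] using And.intro hc hd)) τ
    rw [hw', thetaFactor_eq_thetaAut] at this
    simpa [mkSL] using this
  · intro h γ hγ τ
    have hdet : γ 0 0 * γ 1 1 - γ 0 1 * γ 1 0 = 1 := by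
      rw [← Matrix.det_fin_two]; exact γ.2
    obtain ⟨hc, hd⟩ := (mem_Gamma1_iff _).mp hγ
    push_cast at hc hd
    exact h _ _ _ _ hdet hc hd τ _ ((smul_eq_iff γ τ _).mp rfl)

theorem cuspForms_mono (l : ℕ) {M N : ℕ} (h : M ∣ N) : cuspForms l M ≤ cuspForms l N := by
  intro f hf
  rw [mem_cuspForms_iff] at hf ⊢
  have h' : (4 * M : ℤ) ∣ 4 * N := mul_dvd_mul_left 4 (Int.natCast_dvd_natCast.mpr h)
  exact ⟨hf.1, fun a b c d hdet hc hd => hf.2.1 a b c d hdet (h'.trans hc) (h'.trans hd), hf.2.2⟩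

end Relational

/-! ### Rational affine substitutions and vanishing at cusps. -/

section Affine

/-- The map `τ ↦ (Aτ + B) / D` of the upper half plane. -/
noncomputable def affineMap (A D : ℕ+) (B : ℤ) (τ : ℍ) : ℍ :=
  ⟨((A : ℕ) * (τ : ℂ) + B) / (D : ℕ), by
    have h : (((A : ℕ) * (τ : ℂ) + B) / (D : ℕ)).im = (A : ℕ) * τ.im / (D : ℕ) := by
      rw [Complex.div_natCast_im]; simp
    rw [h]
    have hA : (0 : ℝ) < (A : ℕ) := by exact_mod_cast A.pos
    have hD : (0 : ℝ) < (D : ℕ) := by exact_mod_cast D.pos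
    have := τ.im_pos
    positivity⟩

theorem coe_affineMap (A D : ℕ+) (B : ℤ) (τ : ℍ) :
    (affineMap A D B τ : ℂ) = ((A : ℕ) * (τ : ℂ) + B) / (D : ℕ) := rfl

theorem coe_affineMap_mul (A D : ℕ+) (B : ℤ) (τ : ℍ) :
    (affineMap A D B τ : ℂ) * (D : ℕ) = (A : ℕ) * (τ : ℂ) + B := by
  rw [coe_affineMap, div_mul_cancel₀]
  exact_mod_cast D.ne_zero

theorem im_affineMap (A D : ℕ+) (B : ℤ) (τ : ℍ) :
    (affineMap A D B τ).im = (A : ℕ) * τ.im / (D : ℕ) := by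
  rw [← coe_im, coe_affineMap, Complex.div_natCast_im]; simp

theorem mdifferentiable_comp_affineMap {f : ℍ → ℂ} (hf : MDiff f) (A D : ℕ+) (B : ℤ) :
    MDiff (fun τ => f (affineMap A D B τ)) := by
  rw [mdifferentiable_iff] at hf ⊢
  have hg : DifferentiableOn ℂ (fun z : ℂ => ((A : ℕ) * z + B) / (D : ℕ)) {z | 0 < z.im} := by
    fun_prop
  have hmaps : Set.MapsTo (fun z : ℂ => ((A : ℕ) * z + B) / ((D : ℕ) : ℂ))
      {z | 0 < z.im} {z | 0 < z.im} := fun z hz => (affineMap A D B ⟨z, hz⟩).im_pos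
  refine (hf.comp hg hmaps).congr fun z hz => ?_
  simp only [Function.comp_apply]
  rw [ofComplex_apply_of_im_pos hz, ofComplex_apply_of_im_pos (hmaps hz)]
  rfl

/-- An integer matrix of positive determinant is the product of a matrix in `SL₂(ℤ)` and an upper
triangular matrix with positive diagonal. -/
theorem exists_upperTriangular {a b c d : ℤ} (h : 0 < a * d - b * c) :
    ∃ a' b' c' d' t : ℤ, ∃ g e : ℕ+, a' * d' - b' * c' = 1 ∧
      a = a' * g ∧ c = c' * g ∧ b = a' * t + b' * e ∧ d = c' * t + d' * e := by
  have hg : 0 < Int.gcd a c := Int.gcd_pos_iff.mpr (by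
    by_contra! hac
    rw [hac.1, hac.2] at h; simp at h)
  obtain ⟨a', c', hcop, ha, hc⟩ : ∃ a' c' : ℤ, IsCoprime a' c' ∧
      a = a' * (Int.gcd a c : ℤ) ∧ c = c' * (Int.gcd a c : ℤ) := by
    obtain ⟨a', c', h1, h2, h3⟩ := Int.exists_gcd_one (m := a) (n := c) hg
    exact ⟨a', c', Int.isCoprime_iff_gcd_eq_one.mpr h1, h2, h3⟩
  obtain ⟨u, v, huv⟩ := hcop
  set g : ℤ := (Int.gcd a c : ℤ) with hgdef
  have hgpos : 0 < g := Int.natCast_pos.mpr hg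
  have he : 0 < a' * d - c' * b := by
    have : a * d - b * c = g * (a' * d - c' * b) := by
      conv_lhs => rw [ha, hc]
      ring
    rw [this] at h
    exact (mul_pos_iff_of_pos_left hgpos).mp h
  obtain ⟨e, hee⟩ := Int.eq_ofNat_of_zero_le he.le
  have he' : 0 < e := by omega
  -- Bézout completes the primitive column (a', c') by (-v, u); the inverse of that matrix sends (b,
  -- d) to (t, e).
  refine ⟨a', -v, c', u, u * b + v * d, ⟨_, hg⟩, ⟨e, he'⟩, by linarith, ha, hc, ?_, ?_⟩
  · simp only [PNat.mk_coe]; rw [← hee]; linear_combination (-b) * huv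
  · simp only [PNat.mk_coe]; rw [← hee]; linear_combination (-d) * huv

/-- Write (A B; 0 D)γ = γ'(g t; 0 e). With σ = (gτ + t)/e, Im σ is a positive multiple of Im τ and
|c'σ + d'| is D/e times |cτ + d|, a constant absorbed into ε. -/
theorem VanishesAtCusps.comp_affineMap {l : ℕ} {f : ℍ → ℂ} (hf : VanishesAtCusps l f)
    (A D : ℕ+) (B : ℤ) : VanishesAtCusps l (fun τ => f (affineMap A D B τ)) := by
  intro a b c d hdet ε hε
  have hA : (0 : ℤ) < (A : ℕ) := by exact_mod_cast A.pos
  have hD : (0 : ℤ) < (D : ℕ) := by exact_mod_cast D.pos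
  obtain ⟨a', b', c', d', t, g, e, hdet', h1, h2, h3, h4⟩ :=
    exists_upperTriangular (a := A * a + B * c) (b := A * b + B * d) (c := D * c) (d := D * d) (by
      have : (A * a + B * c) * (D * d) - (A * b + B * d) * (D * c)
        = ((A : ℕ) * (D : ℕ) : ℤ) * (a * d - b * c) := by ring
      rw [this, hdet]; positivity)
  have hDR : (0 : ℝ) < (D : ℕ) := by exact_mod_cast D.pos
  have heR : (0 : ℝ) < (e : ℕ) := by exact_mod_cast e.pos
  have hgR : (0 : ℝ) < (g : ℕ) := by exact_mod_cast g.pos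
  have hDC : ((D : ℕ) : ℂ) ≠ 0 := by exact_mod_cast D.ne_zero
  have heC : ((e : ℕ) : ℂ) ≠ 0 := by exact_mod_cast e.ne_zero
  obtain ⟨Y, hY⟩ := hf a' b' c' d' hdet' (ε * ((e : ℕ) / (D : ℕ) : ℝ) ^ l) (by positivity)
  refine ⟨Y * (e : ℕ) / (g : ℕ), fun τ w hτ hw => ?_⟩
  have h1' : ((A : ℕ) : ℂ) * a + B * c = a' * (g : ℕ) := by exact_mod_cast h1
  have h2' : ((D : ℕ) : ℂ) * c = c' * (g : ℕ) := by exact_mod_cast h2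
  have h3' : ((A : ℕ) : ℂ) * b + B * d = a' * t + b' * (e : ℕ) := by exact_mod_cast h3
  have h4' : ((D : ℕ) : ℂ) * d = c' * t + d' * (e : ℕ) := by exact_mod_cast h4
  have hσ := coe_affineMap_mul g e t τ
  set σ : ℍ := affineMap g e t τ with hσdef
  have hlin : ((c' : ℂ) * σ + d') * (e : ℕ) = (D : ℕ) * (c * τ + d) := by
    linear_combination c' * hσ - τ * h2' - h4'
  have hnorm : ‖(c' : ℂ) * σ + d'‖ = ((D : ℕ) / (e : ℕ) : ℝ) * ‖(c : ℂ) * τ + d‖ := by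
    have := congrArg norm hlin
    rw [norm_mul, norm_mul, Complex.norm_natCast, Complex.norm_natCast] at this
    field_simp
    linarith
  have hYσ : Y ≤ σ.im := by
    rw [hσdef, im_affineMap, le_div_iff₀ heR]
    rw [div_le_iff₀ hgR] at hτ
    linarith
  have hmain := hY σ (affineMap A D B w) hYσ (by
    have hw' := coe_affineMap_mul A D B w
    refine mul_right_cancel₀ (mul_ne_zero heC hDC) ?_
    linear_combination (affineMap A D B w : ℂ) * (D : ℕ) * hlin +
      (D : ℕ) * (c * τ + d) * hw' + (D : ℕ) * (A : ℕ) * hw + (D : ℕ) * τ * h1' + (D : ℕ) * h3' -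
      a' * (D : ℕ) * hσ)
  refine hmain.trans (le_of_eq ?_)
  rw [hnorm, mul_assoc, ← mul_pow]
  congr 2
  field_simp

end Affine

/-! ### Translation by k/p. -/

section Shift

theorem odd_of_four_dvd_sub_one {d : ℤ} (h : 4 ∣ d - 1) : Odd d := by
  rw [Int.odd_iff]; omega

/-- `f(τ + k / p)` is a cusp form of level `p²` times that of `f`. -/
theorem comp_affineMap_mem_cuspForms {l N : ℕ} {f : ℍ → ℂ} (hf : f ∈ cuspForms l N) (p : ℕ+)
    (k : ℤ) : (fun τ => f (affineMap p p k τ)) ∈ cuspForms l (N * p ^ 2) := by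
  rw [mem_cuspForms_iff] at hf ⊢
  refine ⟨mdifferentiable_comp_affineMap hf.1 p p k, ?_, hf.2.2.comp_affineMap p p k⟩
  rintro a b c d hdet ⟨y, hy⟩ ⟨z, hz⟩ τ w hw
  push_cast at hy hz
  have hp0 : ((p : ℕ) : ℂ) ≠ 0 := by exact_mod_cast p.ne_zero
  have hpZ : (0 : ℤ) < (p : ℕ) := by exact_mod_cast p.pos
  set P : ℤ := ((p : ℕ) : ℤ) with hP
  obtain ⟨x, hx⟩ : ∃ x, d - a = P * x := by
    have h1 : a - 1 = 4 * N * P ^ 2 * (b * y - a * z) := by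
      linear_combination hdet + b * hy - a * hz
    exact ⟨4 * N * P * (z - (b * y - a * z)), by linear_combination hz - h1⟩
  have hc : c = P ^ 2 * (4 * N * y) := by rw [hy]; ring
  have hdodd : Odd d := odd_of_four_dvd_sub_one ⟨N * P ^ 2 * z, by rw [hz]; ring⟩
  have hcop : IsCoprime P d := ⟨-(4 * N * P * z), 1, by linear_combination hz⟩
  have hcop' : IsCoprime P (d + 4 * N * y * (-k * P)) :=
    ⟨-(4 * N * P * z) + 4 * N * y * k, 1, by linear_combination hz⟩
  have hxC : (d : ℂ) - a = (p : ℕ) * x := by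
    have := congrArg (Int.cast : ℤ → ℂ) hx
    rw [hP] at this; push_cast at this; exact this
  have hcC : (c : ℂ) = (p : ℕ) ^ 2 * (4 * N * y) := by
    have := congrArg (Int.cast : ℤ → ℂ) hc
    rw [hP] at this; push_cast at this; exact this
  have hτ1 : (affineMap p p k τ : ℂ) = τ + k / (p : ℕ) := by
    rw [coe_affineMap]; field_simp
  have hw1 : (affineMap p p k w : ℂ) = w + k / (p : ℕ) := by
    rw [coe_affineMap]; field_simp
  have hlin : (c : ℂ) * affineMap p p k τ + (d + 4 * N * y * (-k * P) : ℤ) = c * τ + d := by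
    rw [hτ1, hcC, hP]; push_cast; field_simp; ring
  -- This is the conjugate of γ by translation by k/p, integral because p² ∣ c and p ∣ d - a.
  have := hf.2.1 (a + k * P * (4 * N * y)) (b + k * x - k ^ 2 * (4 * N * y)) c
    (d + 4 * N * y * (-k * P)) (by
      linear_combination hdet + (k * x - k ^ 2 * (4 * N * y)) * (-hc) + k * P * (4 * N * y) * hx)
    ⟨P ^ 2 * y, by rw [hc]; ring⟩ ⟨P ^ 2 * z + y * (-k * P), by linear_combination hz⟩
    (affineMap p p k τ) (affineMap p p k w) (by
      rw [hlin, hw1, hτ1, add_mul, hw, hP]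
      push_cast
      field_simp
      linear_combination k * hxC + k * τ * hcC)
  beta_reduce
  rw [this, thetaAut_congr (c := c) (d := d) ⟨N * y * (-k * P), by ring⟩ ?_ hlin]
  -- Once the square p² is dropped from c, the shift in d is a multiple of the remaining numerator.
  rw [hc, extSymbol_sq_mul hpZ hcop', extSymbol_sq_mul hpZ hcop]
  exact extSymbol_add_mul ⟨N * y, by ring⟩ hdodd _

end Shift

/-! ### Periodicity of f(τ/p): lowering the level or vanishing. -/

section Lowering

/-- Conjugation by diag(1, p) gives (a b/p; pc d), and the extra p in the lower left corner costs
the symbol (p/d). -/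
theorem comp_affineMap_transforms {l N : ℕ} {f : ℍ → ℂ} (hf : f ∈ cuspForms l N) (p : ℕ+)
    {a b c d : ℤ} (hdet : a * d - b * c = 1) (hb : ((p : ℕ) : ℤ) ∣ b)
    (hc : (4 * N : ℤ) ∣ (p : ℕ) * c) (hd : (4 * N : ℤ) ∣ d - 1) {τ w : ℍ}
    (hw : (w : ℂ) * (c * τ + d) = a * τ + b) :
    f (affineMap 1 p 0 w) =
      (jacobiSym (p : ℕ) d.natAbs * thetaAut c d τ) ^ l * f (affineMap 1 p 0 τ) := by
  rw [mem_cuspForms_iff] at hf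
  obtain ⟨b', hb⟩ := hb
  have hτ := coe_affineMap_mul 1 p 0 τ
  have hw' := coe_affineMap_mul 1 p 0 w
  have hpZ : (0 : ℤ) < (p : ℕ) := by exact_mod_cast p.pos
  have hp0 : ((p : ℕ) : ℂ) ≠ 0 := by exact_mod_cast p.ne_zero
  have hbC : (b : ℂ) = (p : ℕ) * b' := by exact_mod_cast congrArg (Int.cast : ℤ → ℂ) hb
  simp only [PNat.one_coe, Nat.cast_one, one_mul, Int.cast_zero, add_zero] at hτ hw'
  rw [hf.2.1 a b' ((p : ℕ) * c) d (by rw [← hdet, hb]; ring) hc hd (affineMap 1 p 0 τ)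
    (affineMap 1 p 0 w) (by
      refine mul_right_cancel₀ hp0 ?_
      push_cast
      linear_combination (affineMap 1 p 0 w : ℂ) * (p : ℕ) * c * hτ + (c * τ + d) * hw' + hw
        - a * hτ + hbC),
    thetaAut_mul_left hpZ c d (τ := τ) (by rw [mul_comm]; exact_mod_cast hτ)]

theorem apply_add_int {h : ℍ → ℂ} (hper : ∀ τ w : ℍ, (w : ℂ) = τ + 1 → h w = h τ) (k : ℤ)
    (τ w : ℍ) (hw : (w : ℂ) = τ + k) : h w = h τ := by
  induction k using Int.induction_on generalizing w with
  | zero => congr 1; ext; simpa using hw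
  | succ i ih =>
    have hw1 := ih ((i : ℝ) +ᵥ τ) (by simp [add_comm])
    rw [← hw1]
    refine hper _ _ ?_
    rw [hw]; push_cast; simp; ring
  | pred i ih =>
    have hw1 := ih ((-i : ℝ) +ᵥ τ) (by simp [add_comm])
    rw [← hw1]
    refine (hper _ _ ?_).symm
    rw [hw]; push_cast; simp; ring

/-- Replace γ by T^m γ T^k with T the unit translation: since d + ck is prime to p, a suitable m
makes the upper right entry divisible by p. The integer k stays free, yet it enters the symbol. -/
theorem transforms_of_periodic {l N : ℕ} {f : ℍ → ℂ} (hf : f ∈ cuspForms l N) (p : ℕ+)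
    (hper : ∀ τ w : ℍ, (w : ℂ) = τ + 1 → f (affineMap 1 p 0 w) = f (affineMap 1 p 0 τ))
    {a b c d k : ℤ} (hdet : a * d - b * c = 1) (hc : (4 * N : ℤ) ∣ (p : ℕ) * c) (hc4 : 4 ∣ c)
    (hd : (4 * N : ℤ) ∣ d + c * k - 1) (hpd : IsCoprime ((p : ℕ) : ℤ) (d + c * k)) {τ w : ℍ}
    (hw : (w : ℂ) * (c * τ + d) = a * τ + b) :
    f (affineMap 1 p 0 w) =
      (jacobiSym (p : ℕ) (d + c * k).natAbs * thetaAut c d τ) ^ l * f (affineMap 1 p 0 τ) := by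
  obtain ⟨u, v, huv⟩ := hpd
  set m : ℤ := -(b + a * k) * v with hm
  have hτ := apply_add_int (h := fun τ => f (affineMap 1 p 0 τ)) hper (-k) τ ((-k : ℝ) +ᵥ τ)
    (by simp [add_comm])
  have hw' := apply_add_int (h := fun τ => f (affineMap 1 p 0 τ)) hper m w ((m : ℝ) +ᵥ w)
    (by simp [add_comm])
  have hdodd : Odd d := by
    have h1 : Odd (d + c * k) := odd_of_four_dvd_sub_one ((Dvd.intro _ rfl).trans hd)
    have h2 : Even (c * k) :=
      even_iff_two_dvd.mpr (((by norm_num : (2 : ℤ) ∣ 4).trans hc4).mul_right k)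
    simpa using h1.sub_even h2
  have hlin : (c : ℂ) * (((-k : ℝ) +ᵥ τ : ℍ) : ℂ) + (d + c * k : ℤ) = c * τ + d := by
    push_cast; simp; ring
  have := comp_affineMap_transforms hf p (a := a + m * c) (b := (a + m * c) * k + b + m * d)
    (c := c) (d := d + c * k) (by linear_combination hdet)
    ⟨(b + a * k) * u, by rw [hm]; linear_combination (-(b + a * k)) * huv⟩ hc hd
    (τ := (-k : ℝ) +ᵥ τ) (w := (m : ℝ) +ᵥ w) (by
      rw [hlin]
      push_cast
      simp
      linear_combination hw)
  rw [← hw', this, ← hτ,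
    thetaAut_congr (hc4.trans ⟨k, by ring⟩) (extSymbol_add_mul hc4 hdodd k) hlin]

/-- If `f(τ / p)` has period one and `p` divides the level, then `f(τ / p)` is a cusp form of
level divided by `p`. -/
theorem comp_affineMap_mem_of_periodic {l M : ℕ} {p : ℕ+} (hp : (p : ℕ).Prime) (hM : 0 < M)
    {f : ℍ → ℂ} (hf : f ∈ cuspForms l (p * M))
    (hper : ∀ τ w : ℍ, (w : ℂ) = τ + 1 → f (affineMap 1 p 0 w) = f (affineMap 1 p 0 τ)) :
    (fun τ => f (affineMap 1 p 0 τ)) ∈ cuspForms l M := by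
  have hf' := mem_cuspForms_iff.mp hf
  rw [mem_cuspForms_iff]
  refine ⟨mdifferentiable_comp_affineMap hf'.1 1 p 0, ?_, hf'.2.2.comp_affineMap 1 p 0⟩
  have hpZ : Prime ((p : ℕ) : ℤ) := Nat.prime_iff_prime_int.mp hp
  have hpos : (0 : ℤ) < (p : ℕ) := by exact_mod_cast p.pos
  have unit_case : ∀ a b c' d : ℤ, a * d - b * (4 * M * c') = 1 → ¬ ((p : ℕ) : ℤ) ∣ c' →
      (4 * M : ℤ) ∣ d - 1 → Transforms l (fun τ => f (affineMap 1 p 0 τ)) a b (4 * M * c') d := by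
    rintro a b c' d hdet hc' ⟨d', hd'⟩ τ w hw
    -- Inverting c' mod p gives k with d + ck ≡ 1 mod 4Mp, so the symbol is 1.
    obtain ⟨u, v, huv⟩ := (Prime.coprime_iff_not_dvd hpZ).mpr hc'
    have hk : d + 4 * M * c' * (-d' * v) - 1 = 4 * M * ((p : ℕ) * (d' * u)) := by
      linear_combination hd' + 4 * M * d' * (-huv)
    have hone : 4 * ((p : ℕ) : ℤ) ∣ d + 4 * M * c' * (-d' * v) - 1 :=
      hk ▸ ⟨M * (d' * u), by ring⟩
    have := transforms_of_periodic hf p hper (k := -d' * v) hdet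
      ⟨c', by push_cast; ring⟩ ⟨M * c', by ring⟩ (hk ▸ ⟨d' * u, by push_cast; ring⟩)
      ⟨-(4 * M * (d' * u)), 1, by linear_combination hk⟩ hw
    beta_reduce
    rw [this, jacobiSym_natAbs_congr hpos odd_one hone]
    simp
  rintro a b c d hdet ⟨c', rfl⟩ hd τ w hw
  by_cases hpc : ((p : ℕ) : ℤ) ∣ c'
  · have hpd : ¬ ((p : ℕ) : ℤ) ∣ c' - d := by
      intro h
      have h1 : ((p : ℕ) : ℤ) ∣ d := (dvd_sub_right hpc).mp h
      have h2 : ((p : ℕ) : ℤ) ∣ 1 := by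
        rw [← hdet]; exact dvd_sub (h1.mul_left a) ((hpc.mul_left _).mul_left b)
      exact hpZ.not_isUnit (isUnit_of_dvd_one h2)
    -- Splitting off (1 0; 4M 1) on the right replaces c' by c' - d, which is prime to p; both
    -- factors fall under the previous case.
    set σ : ℍ := mkSL 1 0 (4 * M) 1 (by ring) • τ with hσ
    have hστ := (smul_eq_iff _ τ σ).mp hσ.symm
    simp [mkSL] at hστ
    have hMpos : (0 : ℤ) < 4 * M := by positivity
    have hdet0 : (a - 4 * M * b) * d - b * (4 * M * (c' - d)) = 1 := by linear_combination hdet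
    have h0 : ((4 * M : ℤ) : ℂ) * τ + ((1 : ℤ) : ℂ) ≠ 0 :=
      linear_ne_zero (isCoprime_one_right) τ
    have h1 := unit_case (a - 4 * M * b) b (c' - d) d hdet0 hpd hd σ w (by
      refine mul_right_cancel₀ h0 ?_
      push_cast at hw ⊢
      linear_combination (w * (4 * M * (c' - d)) - (a - 4 * M * b)) * hστ + hw)
    have h2 := unit_case 1 0 1 1 (by ring) (fun h => hpZ.not_isUnit (isUnit_of_dvd_one h))
      (by simp) τ σ (by push_cast; linear_combination hστ)
    have h3 := thetaAut_add_mul hMpos (isCoprime_of_det hdet0) (τ := τ) (w := σ) (by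
      push_cast; linear_combination hστ)
    rw [h1, h2, ← mul_assoc, ← mul_pow, mul_one, ← h3]
    congr 3; ring
  · exact unit_case a b c' d hdet hpc hd τ w hw

/-- If `f(τ / p)` has period one and the odd prime `p` does not divide the level, then `f`
vanishes. -/
theorem eq_zero_of_periodic {l N : ℕ} (hl : Odd l) {p : ℕ+} (hp : (p : ℕ).Prime)
    (hp2 : (p : ℕ) ≠ 2) (hpN : ¬ (p : ℕ) ∣ N) {f : ℍ → ℂ} (hf : f ∈ cuspForms l N)
    (hper : ∀ τ w : ℍ, (w : ℂ) = τ + 1 → f (affineMap 1 p 0 w) = f (affineMap 1 p 0 τ)) :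
    f = 0 := by
  have : Fact (p : ℕ).Prime := ⟨hp⟩
  obtain ⟨r, hr⟩ := quadraticChar_exists_neg_one (F := ZMod p) (by rwa [ZMod.ringChar_zmod_n])
  have hpodd : Odd (p : ℕ) := hp.odd_of_ne_two hp2
  have h4N : ((4 * N : ℕ) : ZMod p) ≠ 0 := by
    rw [Ne, ZMod.natCast_eq_zero_iff, hp.dvd_mul, not_or]
    refine ⟨fun h => hp2 ?_, hpN⟩
    exact (Nat.prime_dvd_prime_iff_eq hp Nat.prime_two).mp (hp.dvd_of_dvd_pow (n := 2) h)
  -- Chosen so that 1 + 4Nx is the nonresidue r mod p; as it is 1 mod 4, reciprocity gives (p/(1 +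
  -- 4Nx)) = -1.
  set x : ℕ := ((r - 1) / ((4 * N : ℕ) : ZMod p)).val with hx
  have hd : ((1 + 4 * N * x : ℕ) : ZMod p) = r := by
    push_cast at h4N ⊢
    rw [hx, ZMod.natCast_zmod_val]
    push_cast
    rw [← mul_div_assoc, mul_div_cancel_left₀ _ h4N]
    ring
  have hJ : jacobiSym ((p : ℕ) : ℤ) (1 + 4 * N * x) = -1 := by
    rw [← jacobiSym.quadratic_reciprocity_one_mod_four (by rw [mul_assoc]; omega) hpodd,
      ← jacobiSym.legendreSym.to_jacobiSym, legendreSym]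
    rw [← hr, ← hd]; push_cast; rfl
  have hcop : IsCoprime ((p : ℕ) : ℤ) (1 + 4 * N * x) := by
    refine (Prime.coprime_iff_not_dvd (Nat.prime_iff_prime_int.mp hp)).mpr fun h => ?_
    have h0 : ((1 + 4 * N * x : ℕ) : ZMod p) = 0 := by
      rw [ZMod.natCast_eq_zero_iff]; exact_mod_cast h
    rw [hd] at h0
    rw [h0] at hr
    simp at hr
  have hzero : ∀ τ, f (affineMap 1 p 0 τ) = 0 := by
    intro τ
    have hdet : (1 : ℤ) * (1 + 4 * N * x) - x * (4 * N) = 1 := by ring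
    set w : ℍ := mkSL 1 x (4 * N) (1 + 4 * N * x) hdet • τ with hwdef
    have hw := (smul_eq_iff _ τ w).mp hwdef.symm
    simp only [mkSL] at hw
    -- For the same matrix, k = 0 gives the symbol -1 and k = -x gives 1; oddness of l makes the two
    -- laws contradictory unless the value is zero.
    have e1 := transforms_of_periodic hf p hper (k := 0) hdet ⟨(p : ℕ), by ring⟩ ⟨N, rfl⟩
      ⟨x, by ring⟩ (by simpa using hcop) hw
    have e2 := transforms_of_periodic hf p hper (k := -x) hdet ⟨(p : ℕ), by ring⟩ ⟨N, rfl⟩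
      ⟨0, by ring⟩ (by ring_nf; exact isCoprime_one_right) hw
    have n1 : (1 + 4 * (N : ℤ) * x + 4 * N * 0).natAbs = 1 + 4 * N * x := by
      rw [mul_zero, add_zero]; exact_mod_cast Int.natAbs_natCast (1 + 4 * N * x)
    have n2 : (1 + 4 * (N : ℤ) * x + 4 * N * -x).natAbs = 1 := by
      ring_nf; rfl
    rw [n1, hJ] at e1
    rw [n2, jacobiSym.one_right, e1] at e2
    have hθ := pow_ne_zero l (thetaAut_ne_zero (isCoprime_of_det hdet) τ)
    have : thetaAut (4 * N) (1 + 4 * N * x) τ ^ l * f (affineMap 1 p 0 τ) = 0 := by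
      have h2 : ((((-1 : ℤ) : ℂ)) * thetaAut (4 * N) (1 + 4 * N * x) τ) ^ l =
        -(thetaAut (4 * N) (1 + 4 * N * x) τ ^ l) := by
        push_cast; rw [neg_one_mul, hl.neg_pow]
      rw [h2] at e2
      push_cast at e2
      rw [one_mul] at e2
      linear_combination (-1 / 2 : ℂ) * e2
    exact (mul_eq_zero.mp this).resolve_left hθ
  ext τ
  have := hzero (affineMap p 1 0 τ)
  have e : affineMap 1 p 0 (affineMap p 1 0 τ) = τ := by
    have hp0 : ((p : ℕ) : ℂ) ≠ 0 := by exact_mod_cast p.ne_zero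
    ext
    simp [coe_affineMap, hp0]
  rwa [e] at this

end Lowering

/-! ### Fourier coefficients, the sieve, and f(τ/p). -/

section QExpansion

open Function.Periodic (qParam)

theorem cuspForms_add_one {l N : ℕ} {f : ℍ → ℂ} (hf : f ∈ cuspForms l N) {τ w : ℍ}
    (h : (w : ℂ) = τ + 1) : f w = f τ := by
  have := (mem_cuspForms_iff.mp hf).2.1 1 1 0 1 (by ring) (by simp) (by simp) τ w (by simpa using h)
  simpa [thetaAut_zero_one] using this

theorem cuspForms_periodic {l N : ℕ} {f : ℍ → ℂ} (hf : f ∈ cuspForms l N) :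
    Function.Periodic (f ∘ ofComplex) ((1 : ℝ) : ℂ) := by
  intro z
  by_cases! hz : 0 < z.im
  · have hz1 : 0 < (z + ((1 : ℝ) : ℂ)).im := by simpa using hz
    simp only [Function.comp_apply, ofComplex_apply_of_im_pos hz, ofComplex_apply_of_im_pos hz1]
    exact cuspForms_add_one hf (by simp)
  -- Off the upper half plane `ofComplex` takes one default value.
  · have hz1 : (z + ((1 : ℝ) : ℂ)).im ≤ 0 := by simpa using hz
    simp only [Function.comp_apply, ofComplex_apply_of_im_nonpos hz,
      ofComplex_apply_of_im_nonpos hz1]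

theorem cuspForms_isBoundedAtImInfty {l N : ℕ} {f : ℍ → ℂ} (hf : f ∈ cuspForms l N) :
    IsBoundedAtImInfty f := by
  have := (hf.2.2 1).isBoundedAtImInfty
  simpa [sqrtDenom] using this

theorem hasSum_qCoeff {l N : ℕ} {f : ℍ → ℂ} (hf : f ∈ cuspForms l N) (τ : ℍ) :
    HasSum (fun n : ℕ => qCoeff f n * qParam 1 τ ^ n) (f τ) :=
  hasSum_qExpansion one_pos (cuspForms_periodic hf) hf.1 (cuspForms_isBoundedAtImInfty hf) τ

theorem qCoeff_eq_of_hasSum {l N : ℕ} {f : ℍ → ℂ} (hf : f ∈ cuspForms l N) {c : ℕ → ℂ}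
    (h : ∀ τ : ℍ, HasSum (fun n : ℕ => c n * qParam 1 τ ^ n) (f τ)) (n : ℕ) :
    qCoeff f n = c n := by
  have ha := analyticAt_cuspFunction_zero one_pos (cuspForms_periodic hf) hf.1
    (cuspForms_isBoundedAtImInfty hf)
  have h1 := (hasFPowerSeriesOnBall_cuspFunction one_pos ha (hasSum_qCoeff hf)).hasFPowerSeriesAt
  have h2 := (hasFPowerSeriesOnBall_cuspFunction one_pos ha h).hasFPowerSeriesAt
  simpa using congrArg (FormalMultilinearSeries.coeff · n) (h1.eq_formalMultilinearSeries h2)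

theorem exists_qCoeff_ne_zero {l N : ℕ} {f : ℍ → ℂ} (hf : f ∈ cuspForms l N) (h0 : f ≠ 0) :
    ∃ n, qCoeff f n ≠ 0 := by
  by_contra! h
  refine h0 (funext fun τ => ?_)
  have := hasSum_qCoeff hf τ
  simp only [h, zero_mul] at this
  exact this.unique hasSum_zero

theorem qParam_affineMap (A D : ℕ+) (B : ℤ) (τ : ℍ) :
    qParam 1 (affineMap A D B τ) ^ (D : ℕ) = qParam 1 τ ^ (A : ℕ) := by
  have hD : ((D : ℕ) : ℂ) ≠ 0 := by exact_mod_cast D.ne_zero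
  rw [qParam, qParam, ← Complex.exp_nat_mul, ← Complex.exp_nat_mul,
    Complex.exp_eq_exp_iff_exists_int]
  refine ⟨B, ?_⟩
  rw [coe_affineMap]
  field_simp
  push_cast
  ring

theorem qParam_affineMap_self (p : ℕ+) (k : ℕ) (τ : ℍ) :
    qParam 1 (affineMap p p k τ) =
      qParam 1 τ * Complex.exp (2 * Real.pi * Complex.I / (p : ℕ)) ^ k := by
  have hp : ((p : ℕ) : ℂ) ≠ 0 := by exact_mod_cast p.ne_zero
  rw [qParam, qParam, ← Complex.exp_nat_mul, ← Complex.exp_add, coe_affineMap]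
  congr 1
  push_cast
  field_simp

/-- The part of the Fourier expansion of `f` supported on integers prime to `p`. -/
noncomputable def sieve (p : ℕ+) (f : ℍ → ℂ) : ℍ → ℂ :=
  f - ((p : ℕ) : ℂ)⁻¹ • ∑ k ∈ Finset.range p, fun τ => f (affineMap p p (k : ℕ) τ)

theorem sieve_mem_cuspForms {l N : ℕ} {f : ℍ → ℂ} (hf : f ∈ cuspForms l N) (p : ℕ+) :
    sieve p f ∈ cuspForms l (N * p ^ 2) :=
  sub_mem (cuspForms_mono l (Dvd.intro _ rfl) hf)
    (Submodule.smul_mem _ _ (sum_mem fun k _ => comp_affineMap_mem_cuspForms hf p k))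

theorem sum_pow_rootOfUnity {p : ℕ+} (n : ℕ) :
    ∑ k ∈ Finset.range p, (Complex.exp (2 * Real.pi * Complex.I / (p : ℕ)) ^ k) ^ n =
      if (p : ℕ) ∣ n then ((p : ℕ) : ℂ) else 0 := by
  have hζ := Complex.isPrimitiveRoot_exp (p : ℕ) p.ne_zero
  set ζ := Complex.exp (2 * Real.pi * Complex.I / (p : ℕ))
  simp_rw [← pow_mul, mul_comm _ n, pow_mul]
  split_ifs with h
  · simp [(hζ.pow_eq_one_iff_dvd n).mpr h]
  · have h1 : ζ ^ n ≠ 1 := fun h' => h ((hζ.pow_eq_one_iff_dvd n).mp h')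
    rw [geom_sum_eq h1, ← pow_mul, mul_comm, pow_mul, hζ.pow_eq_one, one_pow, sub_self, zero_div]

theorem qCoeff_sieve {l N : ℕ} {f : ℍ → ℂ} (hf : f ∈ cuspForms l N) (p : ℕ+) (n : ℕ) :
    qCoeff (sieve p f) n = if (p : ℕ) ∣ n then 0 else qCoeff f n := by
  refine qCoeff_eq_of_hasSum (c := fun n => if (p : ℕ) ∣ n then 0 else qCoeff f n)
    (sieve_mem_cuspForms hf p) (fun τ => ?_) n
  have hp : ((p : ℕ) : ℂ) ≠ 0 := by exact_mod_cast p.ne_zero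
  have h1 := hasSum_sum (s := Finset.range p) fun k _ => hasSum_qCoeff hf (affineMap p p (k : ℕ) τ)
  have h2 := (hasSum_qCoeff hf τ).sub (h1.mul_left ((p : ℕ) : ℂ)⁻¹)
  have e : sieve p f τ =
      f τ - ((p : ℕ) : ℂ)⁻¹ * ∑ k ∈ Finset.range p, f (affineMap p p (k : ℕ) τ) := by
    simp [sieve]
  rw [e]
  convert! h2 using 2 with n
  simp_rw [qParam_affineMap_self, mul_pow, ← mul_assoc]
  rw [← Finset.mul_sum, sum_pow_rootOfUnity]
  split_ifs
  · field_simp; ring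
  · ring

/-- Only the powers q^(pm) occur, and at τ/p they become integral powers of q(τ). -/
theorem apply_affineMap_periodic {l N : ℕ} {f : ℍ → ℂ} (hf : f ∈ cuspForms l N) {p : ℕ+}
    (hsupp : ∀ n, ¬ (p : ℕ) ∣ n → qCoeff f n = 0) (τ w : ℍ) (h : (w : ℂ) = τ + 1) :
    f (affineMap 1 p 0 w) = f (affineMap 1 p 0 τ) := by
  refine (hasSum_qCoeff hf _).unique ?_
  convert! hasSum_qCoeff hf (affineMap 1 p 0 τ) using 2 with n
  by_cases hn : (p : ℕ) ∣ n
  · obtain ⟨m, rfl⟩ := hn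
    have hper : qParam 1 w = qParam 1 τ := by
      rw [qParam, qParam, Complex.exp_eq_exp_iff_exists_int]
      exact ⟨1, by rw [h]; push_cast; ring⟩
    rw [pow_mul, pow_mul, qParam_affineMap, qParam_affineMap, hper]
  · rw [hsupp n hn, zero_mul, zero_mul]

theorem qCoeff_comp_affineMap {l N M : ℕ} {f : ℍ → ℂ} (hf : f ∈ cuspForms l N) {p : ℕ+}
    (hsupp : ∀ n, ¬ (p : ℕ) ∣ n → qCoeff f n = 0)
    (hg : (fun τ => f (affineMap 1 p 0 τ)) ∈ cuspForms l M) (n : ℕ) :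
    qCoeff (fun τ => f (affineMap 1 p 0 τ)) n = qCoeff f (p * n) := by
  refine qCoeff_eq_of_hasSum (c := fun n => qCoeff f (p * n)) hg (fun τ => ?_) n
  have hinj : Function.Injective fun n : ℕ => (p : ℕ) * n :=
    fun a b h => Nat.eq_of_mul_eq_mul_left p.pos h
  have := (hinj.hasSum_iff (f := fun n : ℕ => qCoeff f n * qParam 1 (affineMap 1 p 0 τ) ^ n)
    (a := f (affineMap 1 p 0 τ)) (fun n hn => by
      rw [hsupp n fun ⟨m, hm⟩ => hn ⟨m, hm.symm⟩, zero_mul])).mpr (hasSum_qCoeff hf _)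
  simpa [Function.comp_def, pow_mul, qParam_affineMap] using this

end QExpansion

/-! ### Descent at one prime and induction over the primes. -/

section Main

/-- Removing the multiples of one odd prime `p` from the support of the Fourier expansion. -/
theorem exists_sieve_prime {l : ℕ} (hl : Odd l) {p : ℕ+} (hp : (p : ℕ).Prime)
    (hp2 : (p : ℕ) ≠ 2) (v : ℕ) :
    ∀ {M : ℕ}, 0 < M → ¬ (p : ℕ) ∣ M → ∀ {f : ℍ → ℂ}, f ∈ cuspForms l (p ^ v * M) → f ≠ 0 →
      ∃ i ≤ v, ∃ g ∈ cuspForms l (p ^ (v - i) * M * p ^ 2), g ≠ 0 ∧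
        ∀ n, qCoeff g n = if (p : ℕ) ∣ n then 0 else qCoeff f (p ^ i * n) := by
  induction v with
  | zero =>
    intro M hM hpM f hf hf0
    rw [pow_zero, one_mul] at hf
    refine ⟨0, le_rfl, sieve p f, ?_, fun h => ?_, fun n => ?_⟩
    · simpa using sieve_mem_cuspForms hf p
    · refine hf0 (eq_zero_of_periodic hl hp hp2 hpM hf (apply_affineMap_periodic hf fun n hn => ?_))
      have := qCoeff_sieve hf p n
      rw [h, if_neg hn] at this
      rw [← this]
      exact qCoeff_eq_of_hasSum (c := 0) (zero_mem (cuspForms l M)) (by simp) n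
    · simpa using qCoeff_sieve hf p n
  | succ v ih =>
    intro M hM hpM f hf hf0
    -- Either pass to f(τ/p), lowering v by one, or sieve at once, when a coefficient prime to p
    -- survives.
    by_cases hs : ∀ n, ¬ (p : ℕ) ∣ n → qCoeff f n = 0
    · have hper := apply_affineMap_periodic hf hs
      have hf' : f ∈ cuspForms l (p * (p ^ v * M)) := by
        rwa [← mul_assoc, ← pow_succ']
      have hM' : 0 < (p : ℕ) ^ v * M := Nat.mul_pos (pow_pos p.pos v) hM
      have hg := comp_affineMap_mem_of_periodic hp hM' hf' hper
      have hq := qCoeff_comp_affineMap hf hs hg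
      have hg0 : (fun τ => f (affineMap 1 p 0 τ)) ≠ 0 := by
        obtain ⟨n, hn⟩ := exists_qCoeff_ne_zero hf hf0
        have hpn : (p : ℕ) ∣ n := by by_contra h; exact hn (hs n h)
        obtain ⟨m, rfl⟩ := hpn
        intro h
        rw [← hq m, h] at hn
        exact hn (qCoeff_eq_of_hasSum (c := 0) (zero_mem (cuspForms l M)) (by simp) m)
      obtain ⟨i, hi, g, hg1, hg2, hg3⟩ := ih hM hpM hg hg0
      refine ⟨i + 1, by omega, g, by rwa [Nat.add_sub_add_right], hg2, fun n => ?_⟩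
      rw [hg3 n, hq, ← mul_assoc, ← pow_succ']
    · push Not at hs
      obtain ⟨n, hn, hn0⟩ := hs
      refine ⟨0, by omega, sieve p f, by simpa using sieve_mem_cuspForms hf p, fun h => hn0 ?_,
        fun n => by simpa using qCoeff_sieve hf p n⟩
      have := qCoeff_sieve hf p n
      rw [h, if_neg hn] at this
      rw [← this]
      exact qCoeff_eq_of_hasSum (c := 0) (zero_mem (cuspForms l M)) (by simp) n

/-- Removing the multiples of finitely many odd primes from the support of the Fourier
expansion. -/
theorem exists_sieve_finset {l : ℕ} (hl : Odd l) {L : ℕ} (hL : 0 < L) {f : ℍ → ℂ}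
    (hf : f ∈ cuspForms l L) (hf0 : f ≠ 0) (S : Finset ℕ)
    (hS : ∀ p ∈ S, p.Prime ∧ p ≠ 2) :
    ∃ i : ℕ → ℕ, (∀ p ∈ S, i p ≤ L.factorization p) ∧ ∃ N : ℕ, 0 < N ∧
      (N : ℚ) = L * ∏ p ∈ S, (p : ℚ) ^ (2 - (i p : ℤ)) ∧
      ∃ g ∈ cuspForms l N, g ≠ 0 ∧ ∀ n, qCoeff g n =
        if ∃ p ∈ S, p ∣ n then 0 else qCoeff f ((∏ p ∈ S, p ^ i p) * n) := by
  induction S using Finset.induction_on with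
  | empty => exact ⟨0, by simp, L, hL, by simp, f, hf, hf0, by simp⟩
  | insert q S hq ih =>
    obtain ⟨i, hi, N, hN, hNL, g, hg, hg0, hgc⟩ := ih fun p hp => hS p (Finset.mem_insert_of_mem hp)
    obtain ⟨hqp, hq2⟩ := hS q (Finset.mem_insert_self q S)
    -- Earlier steps alter the level only at primes of S. Since 2 - i p may be negative, the powers
    -- p^(i p) are first moved to the other side.
    have hfac : N.factorization q = L.factorization q := by
      have e : N * ∏ p ∈ S, p ^ i p = L * ∏ p ∈ S, p ^ 2 := by
        have : (N : ℚ) * ∏ p ∈ S, (p : ℚ) ^ i p = L * ∏ p ∈ S, (p : ℚ) ^ 2 := by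
          rw [hNL, mul_assoc, ← Finset.prod_mul_distrib]
          congr 1
          refine Finset.prod_congr rfl fun p hp => ?_
          have hp0 : (p : ℚ) ≠ 0 :=
            Nat.cast_ne_zero.mpr (hS p (Finset.mem_insert_of_mem hp)).1.ne_zero
          rw [← zpow_natCast, ← zpow_add₀ hp0, sub_add_cancel]
          rfl
        exact_mod_cast this
      have hdvd (k : ℕ → ℕ) : ¬ q ∣ ∏ p ∈ S, p ^ k p := fun h => by
        obtain ⟨p, hp, hqp'⟩ := (hqp.prime.dvd_finsetProd_iff _).mp h
        have := (Nat.prime_dvd_prime_iff_eq hqp (hS p (Finset.mem_insert_of_mem hp)).1).mp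
          (hqp.dvd_of_dvd_pow hqp')
        exact hq (this ▸ hp)
      have hne (k : ℕ → ℕ) : ∏ p ∈ S, p ^ k p ≠ 0 := fun h => hdvd k (h ▸ dvd_zero q)
      have e' := congrArg (fun m => m.factorization q) e
      simpa [Nat.factorization_mul hN.ne' (hne i), Nat.factorization_mul hL.ne' (hne fun _ => 2),
        Nat.factorization_eq_zero_of_not_dvd (hdvd i),
        Nat.factorization_eq_zero_of_not_dvd (hdvd fun _ => 2)] using e'
    obtain ⟨M, hqM, hNM⟩ : ∃ M, ¬ q ∣ M ∧ N = q ^ L.factorization q * M := by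
      rw [← hfac]
      exact ⟨N / q ^ N.factorization q, Nat.not_dvd_ordCompl hqp hN.ne',
        (Nat.ordProj_mul_ordCompl_eq_self N q).symm⟩
    have hM : 0 < M := Nat.pos_of_ne_zero fun h => hqM (h ▸ dvd_zero q)
    obtain ⟨j, hj, g', hg', hg0', hgc'⟩ := exists_sieve_prime hl (p := ⟨q, hqp.pos⟩) hqp hq2
      (L.factorization q) hM hqM (hNM ▸ hg) hg0
    simp only [PNat.mk_coe] at hg' hgc'
    have hupd : ∀ p ∈ S, Function.update i q j p = i p := fun p hp =>
      Function.update_of_ne (fun (h : p = q) => hq (h ▸ hp)) _ _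
    have hprod : ∏ p ∈ S, p ^ Function.update i q j p = ∏ p ∈ S, p ^ i p :=
      Finset.prod_congr rfl fun p hp => by rw [hupd p hp]
    refine ⟨Function.update i q j, fun p hp => ?_, q ^ (L.factorization q - j) * M * q ^ 2, ?_, ?_,
      g', hg', hg0', fun n => ?_⟩
    · rcases Finset.mem_insert.mp hp with rfl | hp
      · simpa using hj
      · rw [hupd p hp]; exact hi p hp
    · have := hqp.pos; positivity
    · have hq0 : (q : ℚ) ≠ 0 := by exact_mod_cast hqp.ne_zero
      rw [Finset.prod_insert hq, Function.update_self,
        Finset.prod_congr rfl fun p hp => by rw [hupd p hp], mul_left_comm, ← hNL, hNM]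
      push_cast
      rw [zpow_sub₀ hq0, pow_sub₀ _ hq0 hj]
      norm_cast
      push_cast
      ring
    · rw [hgc' n, hgc, Finset.prod_insert hq, Function.update_self, hprod]
      simp only [Finset.exists_mem_insert]
      by_cases hqn : q ∣ n
      · simp [hqn]
      -- As q ∉ S, the factor q^j does not affect the conditions at the earlier primes.
      · have : (∃ p ∈ S, p ∣ q ^ j * n) ↔ ∃ p ∈ S, p ∣ n := by
          refine exists_congr fun p => and_congr_right fun hp => ?_
          have hpp := (hS p (Finset.mem_insert_of_mem hp)).1
          refine ⟨fun h => ?_, fun h => h.mul_left _⟩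
          refine (hpp.dvd_mul.mp h).resolve_left fun h' => hq ?_
          exact (Nat.prime_dvd_prime_iff_eq hpp hqp).mp (hpp.dvd_of_dvd_pow h') ▸ hp
        simp only [hqn, this, if_false, false_or]
        rw [← mul_assoc, mul_comm (q ^ j)]

end Main

end HalfIntWeight

theorem mainTheorem5 (l : ℕ) (hl : Odd l) (L : ℕ) (hL : 0 < L)
    (Lf : ℕ) (hLf : Lf ∣ 4 * L) (hLf_even : Even Lf)
    (f : UpperHalfPlane → ℂ) (hf : f ∈ HalfIntWeight.cuspForms l L) (hf0 : f ≠ 0)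
    (hfn : ∀ n : ℕ, 1 < Nat.gcd n Lf → HalfIntWeight.qCoeff f n = 0) :
    ∃ i : ℕ → ℕ,
      (∀ p ∈ L.primeFactors \ Lf.primeFactors, i p ≤ L.factorization p) ∧
      ∃ N : ℕ,
        (N : ℚ) = (L : ℚ) * (∏ p ∈ Lf.primeFactors, (p : ℚ)) ^ 2 *
          ∏ p ∈ L.primeFactors \ Lf.primeFactors, (p : ℚ) ^ (2 - (i p : ℤ)) ∧
        ∃ g ∈ HalfIntWeight.cuspForms l N,
          g ≠ 0 ∧
          (∀ n : ℕ, 1 < Nat.gcd n (4 * L) → HalfIntWeight.qCoeff g n = 0) ∧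
          ∀ n : ℕ, Nat.gcd n (4 * L) = 1 →
            HalfIntWeight.qCoeff g n =
              HalfIntWeight.qCoeff f
                ((∏ p ∈ L.primeFactors \ Lf.primeFactors, p ^ i p) * n) := by
  have hLf0 : Lf ≠ 0 := fun h => by rw [h, zero_dvd_iff] at hLf; omega
  have h2 : 2 ∈ Lf.primeFactors :=
    Nat.mem_primeFactors.mpr ⟨Nat.prime_two, hLf_even.two_dvd, hLf0⟩
  obtain ⟨i, hi, N, -, hNL, g, hg, hg0, hgc⟩ := HalfIntWeight.exists_sieve_finset hl hL hf hf0
    (L.primeFactors \ Lf.primeFactors) fun p hp => by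
      rw [Finset.mem_sdiff] at hp
      exact ⟨Nat.prime_of_mem_primeFactors hp.1, fun h => hp.2 (h ▸ h2)⟩
  -- The factor from `Lf` enters only through the inclusion of a level in its multiples.
  refine ⟨i, hi, N * (∏ p ∈ Lf.primeFactors, p) ^ 2, ?_, g,
    HalfIntWeight.cuspForms_mono l (Dvd.intro _ rfl) hg, hg0, fun n hn => ?_, fun n hn => ?_⟩
  · push_cast
    rw [hNL]; ring
  · rw [hgc]
    split_ifs with h
    · rfl
    obtain ⟨q, hq, hqn⟩ := Nat.exists_prime_and_dvd hn.ne'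
    obtain ⟨hqn, hqL⟩ := Nat.dvd_gcd_iff.mp hqn
    -- A prime of 4L that was not sieved out divides `Lf`; this covers q = 2 because `Lf` is even.
    have hqLf : q ∈ Lf.primeFactors := by
      by_contra hqLf
      refine h ⟨q, Finset.mem_sdiff.mpr ⟨Nat.mem_primeFactors.mpr ⟨hq, ?_, hL.ne'⟩, hqLf⟩, hqn⟩
      refine (hq.dvd_mul.mp hqL).resolve_left fun h4 => hqLf ?_
      rwa [(Nat.prime_dvd_prime_iff_eq hq Nat.prime_two).mp (hq.dvd_of_dvd_pow (n := 2) h4)]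
    exact hfn _ (hq.one_lt.trans_le (Nat.le_of_dvd (Nat.gcd_pos_of_pos_right _
      (Nat.pos_of_ne_zero hLf0)) (Nat.dvd_gcd (hqn.mul_left _) (Nat.dvd_of_mem_primeFactors hqLf))))
  · rw [hgc, if_neg]
    rintro ⟨p, hp, hpn⟩
    have hpL := Nat.mem_primeFactors.mp (Finset.mem_sdiff.mp hp).1
    exact hpL.1.one_lt.ne' (Nat.dvd_one.mp (hn ▸ Nat.dvd_gcd hpn (hpL.2.1.mul_left 4)))
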